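/- Theorem. For all positive integers $m$ and $t$ there is an integer $n_0$ such that the following holds for every integer $n\ge n_0$. Let $r$ be the Ramsey number $r(K_{1,n-1},tK_m)$, that is, the least $N$ such that every red-blue colouring of the edges of the complete graph $K_N$ contains a red copy of the star $K_{1,n-1}$ or a blue copy of $tK_m$ (the union of $t$ vertex-disjoint copies of $K_m$). Let $G$ be a Ramsey critical graph for $K_{1,n-1}$ versus $tK_m$, that is, a complete graph on $r-1$ vertices whose edges are coloured red and blue so that there is neither a red copy of $K_{1,n-1}$ nor a blue copy of $tK_m$. Then $G\in\mathcal G_{n,m,t}$; that is, the vertex set of $G$ can be partitioned into sets $V_1,\dots,V_m$ with $|V_i|=n-1$ for $1\le i\le m-1$ and $|V_m|=t-1$ such that, for each $i\le m-1$, all edges inside $V_i$ are red, and all edges between $V_i$ and $V_j$ are blue whenever $i\ne j$ (the edges inside $V_m$ may have arbitrary colours). -/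

import Mathlib

open SimpleGraph

/-- The two colours of a red-blue edge colouring. -/
inductive RBColor
  | red
  | blue

/-- `tG`: the union of `t` vertex-disjoint copies of `G`. -/
def disjointCopies {α : Type*} (t : ℕ) (G : SimpleGraph α) : SimpleGraph (Fin t × α) where
  Adj p q := p.1 = q.1 ∧ G.Adj p.2 q.2
  symm := ⟨fun _ _ h => ⟨h.1.symm, h.2.symm⟩⟩
  loopless := ⟨fun _ h => h.2.ne rfl⟩

/-- The star `K_{1,k}`, a centre joined to `k` leaves. -/
abbrev starK (k : ℕ) : SimpleGraph (Fin 1 ⊕ Fin k) :=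
  completeBipartiteGraph (Fin 1) (Fin k)

/-- `t K_m`: the union of `t` vertex-disjoint complete graphs on `m` vertices. -/
abbrev copiesK (t m : ℕ) : SimpleGraph (Fin t × Fin m) :=
  disjointCopies t (⊤ : SimpleGraph (Fin m))

/-- The red-blue edge colouring `C` of `H` has neither a red copy of `H₁` nor a blue copy of `H₂`
(copies are not necessarily induced). -/
def AvoidsCopies {V α β : Type*} {H : SimpleGraph V} (C : EdgeLabeling H RBColor)
    (H₁ : SimpleGraph α) (H₂ : SimpleGraph β) : Prop :=
  ¬ (H₁ ⊑ C.labelGraph RBColor.red) ∧ ¬ (H₂ ⊑ C.labelGraph RBColor.blue)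

/-- `H → (H₁, H₂)`: every red-blue colouring of the edges of `H` has a red copy of `H₁` or a blue
copy of `H₂`. -/
def Arrows {V α β : Type*} (H : SimpleGraph V) (H₁ : SimpleGraph α) (H₂ : SimpleGraph β) : Prop :=
  ∀ C : EdgeLabeling H RBColor,
    (H₁ ⊑ C.labelGraph RBColor.red) ∨ (H₂ ⊑ C.labelGraph RBColor.blue)

/-- The Ramsey number `r(H₁, H₂)`, the least `N` such that `K_N → (H₁, H₂)`. For finite graphs
`H₁`, `H₂` such an `N` exists. -/
noncomputable def ramseyNumber {α β : Type*} (H₁ : SimpleGraph α) (H₂ : SimpleGraph β) : ℕ :=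
  sInf {N : ℕ | Arrows (⊤ : SimpleGraph (Fin N)) H₁ H₂}

/-- A Ramsey critical graph for `H₁` versus `H₂`: a red-blue edge coloured complete graph on
`r(H₁, H₂) - 1` vertices without a red copy of `H₁` and without a blue copy of `H₂`. -/
def IsRamseyCritical {V α β : Type*} [Fintype V] (C : TopEdgeLabeling V RBColor)
    (H₁ : SimpleGraph α) (H₂ : SimpleGraph β) : Prop :=
  Fintype.card V + 1 = ramseyNumber H₁ H₂ ∧ AvoidsCopies C H₁ H₂

/-- The coloured complete graph `C` belongs to the family `𝒢_{n,m,t}`: its vertex set splits into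
parts `V(H_0), …, V(H_{m-1})` (`part v` is the index of the part of `v`), where each of the first
`m - 1` parts has `n - 1` vertices and only red edges inside, the last part has `t - 1` vertices
(and arbitrary colours inside), and all edges between different parts are blue. -/
def MemFamilyG {V : Type*} [Fintype V] (n m t : ℕ) (C : TopEdgeLabeling V RBColor) : Prop :=
  ∃ part : V → Fin m,
    (∀ i : Fin m, Nat.card {v : V // part v = i} = if (i : ℕ) + 1 < m then n - 1 else t - 1) ∧
    (∀ (u v : V) (h : u ≠ v), part u = part v → (part u : ℕ) + 1 < m →
      C.get u v h = RBColor.red) ∧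
    (∀ (u v : V) (h : u ≠ v), part u ≠ part v → C.get u v h = RBColor.blue)

/-!
Let `G` be the blue graph and write `d = n - 1`, `m = k + 1`. The absence of a red star says that
every vertex of `G` has at most `d` non-neighbours, itself included. Grouping vertices into blocks
of `d` shows that the Ramsey number is at least `k d + t`, so a critical colouring has at least
`k d + t - 1` vertices; any colouring with that many vertices and no forbidden copy already has the
required structure, and the exact value of the Ramsey number is not needed.

Call a vertex set extendable if it lies in an `m`-clique of `G` avoiding any prescribed bounded set.
Then `t` disjoint extendable sets give a blue `t K_m` (`copiesK_isContained_of_isExtendable`).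
Applied to empty sets, this yields a bounded set `F` meeting every `m`-clique. Outside `F` there is
a `k`-clique but no `(k+1)`-clique, and comparing each vertex with a fixed `k`-clique produces
disjoint independent sets `A 1, …, A k` of nearly `d` vertices (`exists_isNearPartition`). By the
degree bound, vertices of `A i` are adjacent to almost everything outside `A i`.

A vertex with many neighbours in every `A i` is extendable; any other vertex has few neighbours in
some `A i`, and is put into a class `V i` for such an `i`. An edge between two vertices of the latter
kind, for the same `i`, is extendable too. Hence there are at most `t - 1` vertices of the
first kind, and no `V i` has more than `d` vertices, since otherwise it would supply an extendable
edge outside `F`. As there are at least `k d + t - 1` vertices, equality holds throughout. An edge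
inside `V i` together with the `t - 1` vertices of the first kind would again give `t` disjoint
extendable sets, so each `V i` is independent; having `d` vertices, it exhausts the non-neighbours
of each of its members, so all edges leaving it are present (`exists_partition`).
-/

namespace StarCliques

open Finset

/-! ### Extendable sets and disjoint cliques -/

open scoped Classical in
/-- The vertices not adjacent to `v` in `G`; this includes `v` itself. -/
noncomputable def nonAdj {V : Type*} [Fintype V] (G : SimpleGraph V) (v : V) : Finset V :=
  {u | ¬ G.Adj v u}

/-- The vertex set `e` lies in an `m`-clique of `G` that avoids any prescribed set of at most `b`
vertices disjoint from `e`. -/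
def IsExtendable {V : Type*} (G : SimpleGraph V) (m b : ℕ) (e : Finset V) : Prop :=
  ∀ F : Finset V, #F ≤ b → Disjoint F e → ∃ Q, G.IsNClique m Q ∧ e ⊆ Q ∧ Disjoint F Q

section

variable {V : Type*} {G : SimpleGraph V}

theorem IsExtendable.card_le {m b : ℕ} {e : Finset V} (h : IsExtendable G m b e) : #e ≤ m := by
  obtain ⟨Q, hQ, hs, -⟩ := h ∅ (by simp) (by simp)
  exact hQ.card_eq ▸ card_le_card hs

/-- Disjoint extendable sets are completed one at a time to disjoint cliques, each avoiding the
cliques already built and the sets still waiting. -/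
theorem exists_disjoint_cliques {ι : Type*} [Fintype ι] {m : ℕ} (f : ι → Finset V)
    (hf : ∀ i j, i ≠ j → Disjoint (f i) (f j))
    (he : ∀ i, IsExtendable G m (m * Fintype.card ι) (f i)) :
    ∃ g : ι → Finset V, (∀ i, G.IsNClique m (g i)) ∧ ∀ i j, i ≠ j → Disjoint (g i) (g j) := by
  classical
  suffices H : ∀ S : Finset ι, ∃ g : ι → Finset V, (∀ i ∈ S, G.IsNClique m (g i)) ∧
      (∀ i ∉ S, g i = f i) ∧ ∀ i j, i ≠ j → Disjoint (g i) (g j) by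
    obtain ⟨g, h1, -, h3⟩ := H univ
    exact ⟨g, fun i => h1 i (mem_univ i), h3⟩
  intro S
  induction S using Finset.induction_on with
  | empty => exact ⟨f, by simp, by simp, hf⟩
  | insert a S ha ih =>
    obtain ⟨g, h1, h2, h3⟩ := ih
    have hcard : ∀ i, #(g i) ≤ m := by
      intro i
      by_cases hi : i ∈ S
      · exact (h1 i hi).card_eq.le
      · rw [h2 i hi]
        exact (he i).card_le
    obtain ⟨Q, hQ, -, hd⟩ := he a ((univ.erase a).biUnion g)
      (by
        refine (card_biUnion_le_card_mul _ _ m fun i _ => hcard i).trans ?_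
        rw [mul_comm]
        exact Nat.mul_le_mul_left m (card_le_univ _))
      (by
        rw [disjoint_biUnion_left, ← h2 a ha]
        exact fun i hi => h3 i a (ne_of_mem_erase hi))
    rw [disjoint_biUnion_left] at hd
    have hd' : ∀ i, i ≠ a → Disjoint (g i) Q := fun i hi => hd i (by simp [hi])
    refine ⟨Function.update g a Q, ?_, ?_, ?_⟩
    · intro i hi
      by_cases h : i = a
      · subst h
        simpa using hQ
      · rw [Function.update_of_ne h]
        exact h1 i ((mem_insert.1 hi).resolve_left h)
    · intro i hi
      rw [mem_insert, not_or] at hi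
      rw [Function.update_of_ne hi.1]
      exact h2 i hi.2
    · intro i j hij
      by_cases h : i = a
      · subst h
        rw [Function.update_self, Function.update_of_ne hij.symm]
        exact (hd' j hij.symm).symm
      · rw [Function.update_of_ne h]
        by_cases h' : j = a
        · subst h'
          rw [Function.update_self]
          exact hd' i h
        · rw [Function.update_of_ne h']
          exact h3 i j hij

theorem copiesK_isContained {t m : ℕ} (g : Fin t → Finset V) (hg : ∀ i, G.IsNClique m (g i))
    (hd : ∀ i j, i ≠ j → Disjoint (g i) (g j)) : copiesK t m ⊑ G := by
  let e : ∀ i, Fin m ≃ g i := fun i =>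
    (Fin.castOrderIso (hg i).card_eq.symm).toEquiv.trans (g i).equivFin.symm
  refine ⟨⟨⟨fun p => (e p.1 p.2 : V), ?_⟩, ?_⟩⟩
  · rintro ⟨i, a⟩ ⟨j, b⟩ ⟨h, hab⟩
    obtain rfl : i = j := h
    refine (hg i).isClique (e i a).2 (e i b).2 fun h => ?_
    exact hab ((e i).injective (Subtype.ext h))
  · rintro ⟨i, a⟩ ⟨j, b⟩ h
    change (e i a : V) = e j b at h
    obtain rfl : i = j := by
      by_contra hij
      exact disjoint_left.1 (hd i j hij) (e i a).2 (h ▸ (e j b).2)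
    rw [(e i).injective (Subtype.ext h)]

/-- Disjoint extendable sets yield disjoint cliques as a copy of `t K_m`. -/
theorem copiesK_isContained_of_isExtendable {ι : Type*} [Fintype ι] {t m : ℕ}
    (hι : Fintype.card ι = t) (f : ι → Finset V) (hf : ∀ i j, i ≠ j → Disjoint (f i) (f j))
    (he : ∀ i, IsExtendable G m (m * t) (f i)) : copiesK t m ⊑ G := by
  subst hι
  obtain ⟨g, h1, h2⟩ := exists_disjoint_cliques f hf he
  let e := (Fintype.equivFin ι).symm
  exact copiesK_isContained (fun i => g (e i)) (fun i => h1 _)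
    fun i j hij => h2 _ _ (e.injective.ne hij)

/-- Disjoint copies of `K_m` fail to exist only if boundedly many vertices meet every `m`-clique. -/
theorem exists_meets_cliques {t m : ℕ} (h : ¬ copiesK t m ⊑ G) :
    ∃ F : Finset V, #F ≤ m * t ∧ ∀ Q, G.IsNClique m Q → ¬ Disjoint F Q := by
  by_contra! H
  refine h (copiesK_isContained_of_isExtendable (Fintype.card_fin t) (fun _ => ∅) (by simp) ?_)
  intro _ F hF _
  obtain ⟨Q, hQ, hd⟩ := H F hF
  exact ⟨Q, hQ, by simp, hd⟩

end

/-! ### Near partitions into independent sets -/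

section

variable {V : Type*} [Fintype V] {G : SimpleGraph V}

@[simp] theorem mem_nonAdj {u v : V} : u ∈ nonAdj G v ↔ ¬ G.Adj v u := by
  simp [nonAdj]

open scoped Classical in
/-- A clique can be completed greedily by one vertex from each of several large sets, provided
each vertex of one set has few non-neighbours in the other sets. -/
theorem exists_clique_extension {κ : Type*} (J : Finset κ) (B : κ → Finset V) (e F : Finset V)
    (c : ℕ) (he : G.IsClique e) (hB : ∀ j ∈ J, ∀ x ∈ B j, ∀ y ∈ e, G.Adj y x)
    (hBB : ∀ i ∈ J, ∀ j ∈ J, i ≠ j → ∀ x ∈ B i, #(B j ∩ nonAdj G x) ≤ c)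
    (hcard : ∀ j ∈ J, #F + #J * c < #(B j)) (hF : Disjoint F e) :
    ∃ Q, G.IsNClique (#e + #J) Q ∧ e ⊆ Q ∧ Disjoint F Q := by
  have H : ∀ S ⊆ J, ∃ P, G.IsNClique #S P ∧ Disjoint F P ∧ ∀ x ∈ P, ∃ j ∈ S, x ∈ B j := by
    intro S
    induction S using Finset.induction_on with
    | empty => exact fun _ => ⟨∅, by simp, by simp, by simp⟩
    | insert a S ha ih =>
      intro hS
      obtain ⟨haJ, hSJ⟩ := insert_subset_iff.1 hS
      obtain ⟨P, hP, hFP, hPB⟩ := ih hSJ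
      have hbad : #(F ∪ P.biUnion fun x => B a ∩ nonAdj G x) < #(B a) := by
        refine (card_union_le _ _).trans_lt (lt_of_le_of_lt ?_ (hcard a haJ))
        refine Nat.add_le_add_left ?_ _
        refine (card_biUnion_le_card_mul _ _ c fun x hx => ?_).trans ?_
        · obtain ⟨j, hj, hxj⟩ := hPB x hx
          exact hBB j (hSJ hj) a haJ (fun h => ha (h ▸ hj)) x hxj
        · rw [hP.card_eq]
          exact Nat.mul_le_mul_right c (card_le_card hSJ)
      obtain ⟨y, hy, hy'⟩ := exists_mem_notMem_of_card_lt_card hbad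
      simp only [mem_union, mem_biUnion, mem_inter, mem_nonAdj, not_or, not_exists, not_and,
        not_not] at hy'
      have hadj : ∀ x ∈ P, G.Adj y x := fun x hx => (hy'.2 x hx hy).symm
      refine ⟨insert y P, ?_, ?_, ?_⟩
      · rw [card_insert_of_notMem ha]
        exact hP.insert hadj
      · rw [disjoint_insert_right]
        exact ⟨hy'.1, hFP⟩
      · intro x hx
        rcases mem_insert.1 hx with rfl | hx
        · exact ⟨a, mem_insert_self _ _, hy⟩
        · obtain ⟨j, hj, hxj⟩ := hPB x hx
          exact ⟨j, mem_insert_of_mem hj, hxj⟩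
  obtain ⟨P, hP, hFP, hPB⟩ := H J Subset.rfl
  have heP : ∀ y ∈ e, ∀ x ∈ P, G.Adj y x := fun y hy x hx => by
    obtain ⟨j, hj, hxj⟩ := hPB x hx
    exact hB j hj x hxj y hy
  refine ⟨e ∪ P, ⟨?_, ?_⟩, subset_union_left, disjoint_union_right.2 ⟨hF, hFP⟩⟩
  · intro x hx y hy hxy
    simp only [coe_union, Set.mem_union, mem_coe] at hx hy
    rcases hx with hx | hx <;> rcases hy with hy | hy
    · exact he hx hy hxy
    · exact heP x hx y hy
    · exact (heP y hy x hx).symm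
    · exact hP.isClique hx hy hxy
  · rw [card_union_of_disjoint, hP.card_eq]
    exact disjoint_left.2 fun x hx hx' => G.loopless.irrefl x (heP x hx x hx')

/-- A family of `k` disjoint independent sets whose sizes fall short of `d` by at most `c`. -/
structure IsNearPartition (G : SimpleGraph V) (d c : ℕ) {k : ℕ} (A : Fin k → Finset V) :
    Prop where
  disjoint : ∀ i j, i ≠ j → Disjoint (A i) (A j)
  le_card : ∀ i, d ≤ #(A i) + c
  subset_nonAdj : ∀ i, ∀ x ∈ A i, A i ⊆ nonAdj G x

/-- If each vertex has at most `d` non-neighbours, a set of more than `(k - 1) d` vertices contains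
a `k`-clique. -/
theorem exists_clique_of_card {d k : ℕ} (hd : ∀ v, #(nonAdj G v) ≤ d) (W : Finset V)
    (hW : ∀ j < k, j * d < #W) : ∃ K ⊆ W, G.IsNClique k K := by
  classical
  induction k with
  | zero => exact ⟨∅, by simp, by simp⟩
  | succ k ih =>
    obtain ⟨K, hKW, hK⟩ := ih fun j hj => hW j (by omega)
    have : #(K.biUnion (nonAdj G)) < #W := by
      refine (card_biUnion_le_card_mul _ _ d fun x _ => hd x).trans_lt ?_
      rw [hK.card_eq]
      exact hW k (by omega)
    obtain ⟨y, hy, hy'⟩ := exists_mem_notMem_of_card_lt_card this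
    simp only [mem_biUnion, mem_nonAdj, not_exists, not_and, not_not] at hy'
    exact ⟨insert y K, insert_subset hy hKW, hK.insert fun x hx => (hy' x hx).symm⟩

/-- A large set `W` without a `(k+1)`-clique in a graph whose vertices have at most `d`
non-neighbours is nearly covered by `k` independent sets of about `d` vertices. For a `k`-clique
`K` in `W`, they are formed, for `v` in `K`, by the vertices of `W` adjacent to all of `K` but
`v`. -/
theorem exists_isNearPartition {d c k : ℕ} (hd : ∀ v, #(nonAdj G v) ≤ d) (hcd : c < d)
    (W : Finset V) (hW : k * d ≤ #W + c) (hfree : ∀ Q ⊆ W, ¬ G.IsNClique (k + 1) Q) :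
    ∃ A : Fin k → Finset V, IsNearPartition G d c A := by
  classical
  obtain ⟨K, hKW, hK⟩ := exists_clique_of_card (k := k) hd W (by
    intro j hj
    have : (j + 1) * d ≤ k * d := Nat.mul_le_mul_right d hj
    rw [Nat.succ_mul] at this
    omega)
  let A : V → Finset V := fun v => W \ (K.erase v).biUnion (nonAdj G)
  have hA : ∀ v x, x ∈ A v ↔ x ∈ W ∧ ∀ u ∈ K, u ≠ v → G.Adj u x := by
    intro v x
    simp only [A, mem_sdiff, mem_biUnion, mem_erase, mem_nonAdj, not_exists, not_and, not_not]
    exact and_congr_right fun _ => ⟨fun h u hu hv => h u ⟨hv, hu⟩, fun h u hu => h u hu.2 hu.1⟩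
  have hcover : ∀ x ∈ W, ∃ u ∈ K, ¬ G.Adj u x := by
    intro x hx
    by_contra! h
    exact hfree (insert x K) (insert_subset hx hKW) (hK.insert fun b hb => (h b hb).symm)
  have hnot : ∀ v ∈ K, ∀ x ∈ A v, ¬ G.Adj v x := by
    intro v hv x hx hvx
    rw [hA] at hx
    obtain ⟨u, hu, hux⟩ := hcover x hx.1
    by_cases h : u = v
    · exact hux (h ▸ hvx)
    · exact hux (hx.2 u hu h)
  let e : Fin k ≃ K := (Fin.castOrderIso hK.card_eq.symm).toEquiv.trans K.equivFin.symm
  refine ⟨fun i => A (e i), ⟨?_, ?_, ?_⟩⟩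
  · intro i j hij
    refine disjoint_left.2 fun x hx hx' => ?_
    have hne : (e i : V) ≠ e j := fun h => hij (e.injective (Subtype.ext h))
    exact hnot _ (e i).2 x hx (((hA _ _).1 hx').2 _ (e i).2 hne)
  · intro i
    have h1 : #((K.erase (e i)).biUnion (nonAdj G)) ≤ (k - 1) * d := by
      refine (card_biUnion_le_card_mul _ _ d fun x _ => hd x).trans ?_
      rw [card_erase_of_mem (e i).2, hK.card_eq]
    have h2 : #W ≤ #(A (e i)) + #((K.erase (e i)).biUnion (nonAdj G)) :=
      card_le_card_sdiff_add_card
    have h3 : (k - 1) * d + d = k * d := by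
      rw [← Nat.succ_mul, Nat.succ_eq_add_one, Nat.sub_add_cancel (Nat.zero_lt_of_lt i.2)]
    change d ≤ #(A (e i)) + c
    omega
  · intro i x hx y hy
    rw [mem_nonAdj]
    intro hxy
    rw [hA] at hx hy
    have hy' : ∀ b ∈ K.erase (e i : V), G.Adj y b := fun b hb =>
      (hy.2 b (mem_of_mem_erase hb) (ne_of_mem_erase hb)).symm
    have hx' : ∀ b ∈ insert y (K.erase (e i : V)), G.Adj x b := by
      intro b hb
      rcases mem_insert.1 hb with rfl | hb
      · exact hxy
      · exact (hx.2 b (mem_of_mem_erase hb) (ne_of_mem_erase hb)).symm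
    have hclique := (((hK.erase_of_mem (e i).2).insert hy').insert hx')
    have hk : k - 1 + 1 + 1 = k + 1 := by have := i.2; omega
    rw [hk] at hclique
    refine hfree _ ?_ hclique
    exact insert_subset hx.1 (insert_subset hy.1 ((erase_subset _ _).trans hKW))

end

/-! ### The structure of the blue graph -/

section

variable {V : Type*} [Fintype V] {G : SimpleGraph V} {d c k : ℕ} {A : Fin k → Finset V}

open scoped Classical in
theorem IsNearPartition.card_nonAdj_sdiff_le (hA : IsNearPartition G d c A)
    (hd : ∀ v, #(nonAdj G v) ≤ d) {i : Fin k} {x : V} (hx : x ∈ A i) :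
    #(nonAdj G x \ A i) ≤ c := by
  have h := card_sdiff_add_card_eq_card (hA.subset_nonAdj i x hx)
  have := hd x
  have := hA.le_card i
  omega

open scoped Classical in
theorem IsNearPartition.card_inter_nonAdj_le (hA : IsNearPartition G d c A)
    (hd : ∀ v, #(nonAdj G v) ≤ d) {i j : Fin k} (hij : i ≠ j) {x : V} (hx : x ∈ A i) :
    #(A j ∩ nonAdj G x) ≤ c := by
  refine (card_le_card fun y hy => ?_).trans (hA.card_nonAdj_sdiff_le hd hx)
  rw [mem_inter] at hy
  exact mem_sdiff.2 ⟨hy.2, fun h => disjoint_left.1 (hA.disjoint i j hij) h hy.1⟩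

open scoped Classical in
/-- A vertex with few neighbours in `A i` has few non-neighbours in each other `A j`. -/
theorem IsNearPartition.card_inter_nonAdj_le_of_near (hA : IsNearPartition G d c A)
    (hd : ∀ v, #(nonAdj G v) ≤ d) {l : ℕ} {i j : Fin k} (hij : i ≠ j) {x : V}
    (hx : #(A i \ nonAdj G x) ≤ l) : #(A j ∩ nonAdj G x) ≤ c + l := by
  have h1 := card_sdiff_add_card_inter (A i) (nonAdj G x)
  have h2 : #(A i ∩ nonAdj G x) + #(A j ∩ nonAdj G x) ≤ #(nonAdj G x) := by
    rw [← card_union_of_disjoint]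
    · exact card_le_card (union_subset inter_subset_right inter_subset_right)
    · exact (hA.disjoint i j hij).mono inter_subset_left inter_subset_left
  have := hd x
  have := hA.le_card i
  omega

open scoped Classical in
/-- A vertex with many neighbours in every `A i` extends to a clique through all of them. -/
theorem IsNearPartition.isExtendable_singleton (hA : IsNearPartition G d c A)
    (hd : ∀ v, #(nonAdj G v) ≤ d) {x : V} (hx : ∀ i, c + k * c < #(A i \ nonAdj G x)) :
    IsExtendable G (k + 1) c {x} := by
  intro F hFc hF
  obtain ⟨Q, hQ, h⟩ := exists_clique_extension (G := G) univ (fun i => A i \ nonAdj G x) {x} F c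
    (by simp) (by simp) (by
      intro i _ j _ hij y hy
      refine (card_le_card ?_).trans (hA.card_inter_nonAdj_le hd hij (mem_sdiff.1 hy).1)
      exact inter_subset_inter_right sdiff_subset) (by
      intro j _
      rw [card_univ, Fintype.card_fin]
      have := hx j
      omega) hF
  refine ⟨Q, ?_, h⟩
  rwa [card_singleton, card_univ, Fintype.card_fin, add_comm] at hQ

open scoped Classical in
/-- Two adjacent vertices with few neighbours in `A i` extend to a clique through the other `A j`:
both are adjacent to almost all of each `A j`. -/
theorem IsNearPartition.isExtendable_pair (hA : IsNearPartition G d c A)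
    (hd : ∀ v, #(nonAdj G v) ≤ d) {l : ℕ} (hl : 4 * c + 2 * l + k * c < d) {i : Fin k}
    {x y : V} (hxy : G.Adj x y) (hx : #(A i \ nonAdj G x) ≤ l) (hy : #(A i \ nonAdj G y) ≤ l) :
    IsExtendable G (k + 1) c {x, y} := by
  intro F hFc hF
  have hk : #(univ.erase i) = k - 1 := by
    rw [card_erase_of_mem (mem_univ i), card_univ, Fintype.card_fin]
  obtain ⟨Q, hQ, h⟩ := exists_clique_extension (G := G) (univ.erase i)
    (fun j => A j \ (nonAdj G x ∪ nonAdj G y)) {x, y} F c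
    (by
      rw [coe_pair, isClique_pair]
      exact fun _ => hxy) (by
      intro j _ z hz w hw
      simp only [mem_sdiff, mem_union, mem_nonAdj, not_or, not_not] at hz
      rcases mem_insert.1 hw with rfl | hw
      · exact hz.2.1
      · rw [mem_singleton.1 hw]
        exact hz.2.2) (by
      intro j _ j' _ hij z hz
      refine (card_le_card ?_).trans (hA.card_inter_nonAdj_le hd hij (mem_sdiff.1 hz).1)
      exact inter_subset_inter_right sdiff_subset) (by
      intro j hj
      have hij : i ≠ j := (ne_of_mem_erase hj).symm
      have h1 := hA.card_inter_nonAdj_le_of_near hd hij hx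
      have h2 := hA.card_inter_nonAdj_le_of_near hd hij hy
      have h3 := card_sdiff_add_card_inter (A j) (nonAdj G x ∪ nonAdj G y)
      rw [inter_union_distrib_left] at h3
      have h4 := card_union_le (A j ∩ nonAdj G x) (A j ∩ nonAdj G y)
      have h5 := hA.le_card j
      have h6 : #(univ.erase i) * c ≤ k * c := Nat.mul_le_mul_right c (by omega)
      omega) hF
  refine ⟨Q, ?_, h⟩
  rw [card_pair hxy.ne, hk] at hQ
  have : 2 + (k - 1) = k + 1 := by have := i.2; omega
  rwa [this] at hQ

open scoped Classical in
/-- Among more than `d` vertices with few neighbours in `A i`, a pair of adjacent vertices can be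
found outside a given small set `F`: some `x` in `A i` has no neighbour among those of these
vertices that lie in `F`, and the degree bound gives `x` a neighbour among the others. -/
theorem IsNearPartition.exists_adj_of_card (hA : IsNearPartition G d c A)
    (hd : ∀ v, #(nonAdj G v) ≤ d) {l b : ℕ} (hl : c + b + b * l < d) {i : Fin k}
    {S F : Finset V} (hS : d < #S) (hSl : ∀ x ∈ S, #(A i \ nonAdj G x) ≤ l) (hF : #F ≤ b) :
    ∃ x ∈ A i, ∃ y ∈ S, G.Adj x y ∧ x ∉ F ∧ y ∉ F := by
  have h1 : #(F ∪ (F ∩ S).biUnion fun y => A i \ nonAdj G y) < #(A i) := by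
    have h2 := card_union_le F ((F ∩ S).biUnion fun y => A i \ nonAdj G y)
    have h3 : #((F ∩ S).biUnion fun y => A i \ nonAdj G y) ≤ #(F ∩ S) * l :=
      card_biUnion_le_card_mul _ _ l fun y hy => hSl y (mem_inter.1 hy).2
    have h4 : #(F ∩ S) * l ≤ b * l :=
      Nat.mul_le_mul_right l ((card_le_card inter_subset_left).trans hF)
    have := hA.le_card i
    omega
  obtain ⟨x, hx, hx'⟩ := exists_mem_notMem_of_card_lt_card h1
  obtain ⟨y, hy, hy'⟩ := exists_mem_notMem_of_card_lt_card ((hd x).trans_lt hS)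
  rw [mem_nonAdj, not_not] at hy'
  simp only [mem_union, mem_biUnion, mem_inter, mem_sdiff, mem_nonAdj, not_or, not_exists,
    not_and, not_not] at hx'
  exact ⟨x, hx, y, hy, hy', hx'.1, fun h => hx'.2 y ⟨h, hy⟩ hx hy'.symm⟩

open scoped Classical in
/-- The structure theorem in terms of the blue graph `G`: the vertices with many neighbours in every
`A i` form the last part, and each other vertex joins a part `i` for which it has few neighbours
in `A i`. Here `c` bounds both the exceptional set `F` and the sets that an extension must avoid, and
having more than `l` neighbours in each `A i` suffices for a greedy extension through all of them. -/
theorem exists_partition {d k t : ℕ} (hd : ∀ v, #(nonAdj G v) ≤ d)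
    (hN : k * d + t ≤ Fintype.card V + 1) (hfree : ¬ copiesK t (k + 1) ⊑ G) {c l : ℕ}
    (hc : c = (k + 1) * t) (hl : l = c + k * c) (hlarge : 3 * c + 3 * l + c * l < d) :
    ∃ part : V → Fin (k + 1), (∀ i : Fin k, #{v | part v = i.castSucc} = d) ∧
      #{v | part v = Fin.last k} + 1 = t ∧
      (∀ u v, ∀ i : Fin k, part u = i.castSucc → part v = i.castSucc → ¬ G.Adj u v) ∧
      ∀ u v, part u ≠ part v → G.Adj u v := by
  obtain ⟨F, hFc, hF⟩ := exists_meets_cliques hfree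
  rw [← hc] at hFc
  have ht : 0 < t := by
    refine Nat.pos_of_ne_zero fun h => hfree ?_
    subst h
    exact IsContained.of_isEmpty
  obtain ⟨A, hA⟩ := exists_isNearPartition (c := c) (k := k) hd (by omega) Fᶜ
    (by
      have := card_add_card_compl F
      omega)
    (fun Q hQ h => hF Q h (disjoint_left.2 fun x hx hx' => mem_compl.1 (hQ hx') hx))
  let part : V → Fin (k + 1) := fun x =>
    if h : ∃ i, #(A i \ nonAdj G x) ≤ l then h.choose.castSucc else Fin.last k
  have hpart : ∀ x (i : Fin k), part x = i.castSucc → #(A i \ nonAdj G x) ≤ l := by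
    intro x i hx
    by_cases h : ∃ i, #(A i \ nonAdj G x) ≤ l
    · simp only [part, dif_pos h] at hx
      rw [← Fin.castSucc_injective k hx]
      exact h.choose_spec
    · simp only [part, dif_neg h] at hx
      exact absurd hx.symm (Fin.castSucc_lt_last i).ne
  have hlast : ∀ x, part x = Fin.last k → ∀ i, c + k * c < #(A i \ nonAdj G x) := by
    intro x hx
    by_cases h : ∃ i, #(A i \ nonAdj G x) ≤ l
    · simp only [part, dif_pos h] at hx
      exact absurd hx (Fin.castSucc_lt_last _).ne
    · simpa only [not_exists, not_le, hl] using h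
  have hsingle : ∀ x, part x = Fin.last k → IsExtendable G (k + 1) ((k + 1) * t) {x} :=
    fun x hx => hc ▸ hA.isExtendable_singleton hd (hlast x hx)
  have hpair : ∀ x y (i : Fin k), G.Adj x y → #(A i \ nonAdj G x) ≤ l → #(A i \ nonAdj G y) ≤ l →
      IsExtendable G (k + 1) ((k + 1) * t) {x, y} :=
    fun x y i hxy hx hy => hc ▸ hA.isExtendable_pair hd (by omega) hxy hx hy
  have hR : #{v | part v = Fin.last k} < t := by
    by_contra! h
    obtain ⟨R, hR, hRt⟩ := exists_subset_card_eq h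
    refine hfree (copiesK_isContained_of_isExtendable (ι := R) ((Fintype.card_coe R).trans hRt)
      (fun x => {(x : V)}) ?_ fun x => hsingle x (by simpa using hR x.2))
    intro x y hxy
    exact disjoint_singleton.2 fun h => hxy (Subtype.ext h)
  have hle : ∀ i : Fin k, #{v | part v = i.castSucc} ≤ d := by
    intro i
    by_contra! h
    obtain ⟨x, hx, y, hy, hxy, hxF, hyF⟩ := hA.exists_adj_of_card hd (l := l) (b := c) (by omega)
      h (fun x hx => hpart x i (by simpa using hx)) hFc
    have hxl : #(A i \ nonAdj G x) ≤ l := by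
      rw [sdiff_eq_empty_iff_subset.2 (hA.subset_nonAdj i x hx)]
      simp
    obtain ⟨Q, hQ, -, hFQ⟩ := hpair x y i hxy hxl (hpart y i (by simpa using hy)) F (hc ▸ hFc)
      (by simp [hxF, hyF])
    exact hF Q hQ hFQ
  have hsum : Fintype.card V = ∑ i : Fin k, #{v | part v = i.castSucc} +
      #{v | part v = Fin.last k} := by
    rw [← Fin.sum_univ_castSucc fun i => #{v | part v = i}, ← card_univ]
    exact card_eq_sum_card_fiberwise fun _ _ => mem_coe.2 (mem_univ _)
  have hsum_le : ∑ i : Fin k, #{v | part v = i.castSucc} ≤ ∑ _i : Fin k, d :=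
    sum_le_sum fun i _ => hle i
  have hconst : ∑ _i : Fin k, d = k * d := by simp
  have hRt : #{v | part v = Fin.last k} + 1 = t := by omega
  have heq : ∀ i : Fin k, #{v | part v = i.castSucc} = d := fun i =>
    (sum_eq_sum_iff_of_le fun i _ => hle i).1 (by omega) i (mem_univ i)
  have hind : ∀ u v, ∀ i : Fin k, part u = i.castSucc → part v = i.castSucc → ¬ G.Adj u v := by
    intro u v i hu hv huv
    -- The edge `uv` and the `t - 1` vertices of the last part are `t` disjoint extendable sets.
    let R : Finset V := {v | part v = Fin.last k}
    have hne : ∀ x ∈ R, x ≠ u ∧ x ≠ v := by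
      intro x hx
      have hx' : part x = Fin.last k := (mem_filter.1 hx).2
      refine ⟨?_, ?_⟩ <;> rintro rfl
      · exact (Fin.castSucc_lt_last i).ne (hu.symm.trans hx')
      · exact (Fin.castSucc_lt_last i).ne (hv.symm.trans hx')
    let f : Option R → Finset V := fun o => o.elim {u, v} fun x => {(x : V)}
    refine hfree (copiesK_isContained_of_isExtendable (ι := Option R)
      (by rw [Fintype.card_option, Fintype.card_coe]; exact hRt) f ?_ ?_)
    · rintro (_ | x) (_ | y) hxy
      · exact absurd rfl hxy
      · simpa [f] using hne y y.2
      · simpa [f, eq_comm] using hne x x.2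
      · exact disjoint_singleton.2 fun h => hxy (congrArg some (Subtype.ext h))
    · rintro (_ | x)
      · exact hpair u v i huv (hpart u i hu) (hpart v i hv)
      · exact hsingle x (mem_filter.1 x.2).2
  have hcross : ∀ u v, ∀ i : Fin k, part u = i.castSucc → part v ≠ part u → G.Adj u v := by
    intro u v i hu hv
    have hsub : ({v | part v = i.castSucc} : Finset V) ⊆ nonAdj G u := by
      intro w hw
      exact mem_nonAdj.2 (hind u w i hu (by simpa using hw))
    have := eq_of_subset_of_card_le hsub (by rw [heq i]; exact hd u)
    by_contra h
    rw [← mem_nonAdj, ← this, mem_filter] at h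
    exact hv (h.2.trans hu.symm)
  refine ⟨part, heq, hRt, hind, fun u v huv => ?_⟩
  rcases Fin.eq_castSucc_or_eq_last (part u) with ⟨i, hi⟩ | hu
  · exact hcross u v i hi huv.symm
  · rcases Fin.eq_castSucc_or_eq_last (part v) with ⟨j, hj⟩ | hv
    · exact (hcross v u j hj huv).symm
    · exact absurd (hu.trans hv.symm) huv

end

/-! ### Colourings and the lower bound on the Ramsey number -/

theorem red_or_blue {V : Type*} (C : TopEdgeLabeling V RBColor) {u v : V} (h : u ≠ v) :
    C.get u v h = RBColor.red ∨ C.get u v h = RBColor.blue := by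
  cases C.get u v h
  · exact Or.inl rfl
  · exact Or.inr rfl

theorem get_eq_blue_of_adj {V : Type*} {C : TopEdgeLabeling V RBColor} {u v : V} (h : u ≠ v)
    (hb : (C.labelGraph RBColor.blue).Adj u v) : C.get u v h = RBColor.blue := by
  obtain ⟨_, h'⟩ := (TopEdgeLabeling.labelGraph_adj u v).1 hb
  exact h'

theorem get_eq_red_of_not_adj {V : Type*} {C : TopEdgeLabeling V RBColor} {u v : V} (h : u ≠ v)
    (hb : ¬ (C.labelGraph RBColor.blue).Adj u v) : C.get u v h = RBColor.red :=
  (red_or_blue C h).resolve_right fun h' => hb ((TopEdgeLabeling.labelGraph_adj u v).2 ⟨h, h'⟩)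

/-- A vertex with `d` neighbours is the centre of a star with `d` leaves. -/
theorem starK_isContained {V : Type*} {G : SimpleGraph V} {d : ℕ} {v : V} (S : Finset V)
    (hS : ∀ u ∈ S, G.Adj v u) (hd : #S = d) : starK d ⊑ G := by
  let e : Fin d ≃ S := (Fin.castOrderIso hd.symm).toEquiv.trans S.equivFin.symm
  refine ⟨⟨⟨Sum.elim (fun _ => v) fun i => (e i : V), ?_⟩, ?_⟩⟩
  · rintro (a | a) (b | b) h
    · simp at h
    · exact hS _ (e b).2
    · exact (hS _ (e a).2).symm
    · simp at h
  · rintro (a | a) (b | b) h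
    · rw [Subsingleton.elim a b]
    · exact absurd h (hS _ (e b).2).ne
    · exact absurd h (hS _ (e a).2).ne'
    · exact congrArg Sum.inr (e.injective (Subtype.ext h))

/-- Without a red star with `d` leaves, each vertex is joined in blue to all but at most `d`
vertices, itself included among the exceptions. -/
theorem card_nonAdj_le {V : Type*} [Fintype V] {C : TopEdgeLabeling V RBColor} {d : ℕ}
    (h : ¬ starK d ⊑ C.labelGraph RBColor.red) (v : V) :
    #(nonAdj (C.labelGraph RBColor.blue) v) ≤ d := by
  classical
  by_contra! hlt
  have hv : v ∈ nonAdj (C.labelGraph RBColor.blue) v := by simp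
  have : d ≤ #((nonAdj (C.labelGraph RBColor.blue) v).erase v) := by
    rw [card_erase_of_mem hv]
    omega
  obtain ⟨S, hS, hSd⟩ := exists_subset_card_eq this
  refine h (starK_isContained (v := v) S (fun u hu => ?_) hSd)
  have hu' := mem_erase.1 (hS hu)
  exact (TopEdgeLabeling.labelGraph_adj v u).2
    ⟨hu'.1.symm, get_eq_red_of_not_adj hu'.1.symm (mem_nonAdj.1 hu'.2)⟩

/-- The colouring of `K_N` whose red edges join the vertices in the same block of `d` consecutive
ones. -/
def blockColoring (N d : ℕ) : TopEdgeLabeling (Fin N) RBColor :=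
  EdgeLabeling.mk (fun x y _ => if (x : ℕ) / d = y / d then RBColor.red else RBColor.blue)
    fun x y _ => by simp only [eq_comm]

theorem blockColoring_red {N d : ℕ} {x y : Fin N} :
    ((blockColoring N d).labelGraph RBColor.red).Adj x y → (x : ℕ) / d = y / d := by
  rw [TopEdgeLabeling.labelGraph_adj]
  rintro ⟨h, h'⟩
  rw [blockColoring, EdgeLabeling.get_mk] at h'
  by_contra hne
  simp [hne] at h'

theorem blockColoring_blue {N d : ℕ} {x y : Fin N} :
    ((blockColoring N d).labelGraph RBColor.blue).Adj x y → (x : ℕ) / d ≠ y / d := by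
  rw [TopEdgeLabeling.labelGraph_adj]
  rintro ⟨h, h'⟩ heq
  rw [blockColoring, EdgeLabeling.get_mk] at h'
  simp [heq] at h'

/-- A red star with `d` leaves would need `d + 1` vertices in one block. -/
theorem blockColoring_not_red {N d : ℕ} (hd : 0 < d) :
    ¬ starK d ⊑ (blockColoring N d).labelGraph RBColor.red := by
  rintro ⟨f⟩
  have hblock : ∀ a, ((f a : Fin N) : ℕ) / d = (f (Sum.inl 0) : Fin N) / d := by
    rintro (a | a)
    · rw [Subsingleton.elim a 0]
    · exact (blockColoring_red (f.toHom.map_adj (by simp : (starK d).Adj (.inl 0) (.inr a)))).symm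
  let q := ((f (Sum.inl 0) : Fin N) : ℕ) / d
  have hcard := card_le_card_of_injOn (s := univ) (t := Ico (q * d) (q * d + d))
    (fun a => ((f a : Fin N) : ℕ)) (by
      intro a _
      have h1 := Nat.div_add_mod ((f a : Fin N) : ℕ) d
      have h2 := Nat.mod_lt ((f a : Fin N) : ℕ) hd
      rw [hblock a, mul_comm] at h1
      change q * d + ((f a : Fin N) : ℕ) % d = _ at h1
      rw [mem_coe, mem_Ico]
      change q * d ≤ ((f a : Fin N) : ℕ) ∧ ((f a : Fin N) : ℕ) < q * d + d
      omega)
    fun a _ b _ h => f.injective (Fin.ext h)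
  simp at hcard

/-- The vertices of a blue `K_{k+1}` lie in distinct blocks, so one of them lies in the block of
number `k`, which has fewer than `t` vertices. -/
theorem blockColoring_not_blue {N d k t : ℕ} (hd : 0 < d) (ht : 0 < t) (htd : t ≤ d)
    (hN : N + 1 ≤ k * d + t) :
    ¬ copiesK t (k + 1) ⊑ (blockColoring N d).labelGraph RBColor.blue := by
  rintro ⟨f⟩
  have hlt : ∀ x : Fin N, (x : ℕ) / d < k + 1 := by
    intro x
    rw [Nat.div_lt_iff_lt_mul hd, Nat.succ_mul]
    have := x.2
    omega
  have hlast : ∀ i : Fin t, ∃ a : Fin (k + 1), ((f (i, a) : Fin N) : ℕ) / d = k := by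
    intro i
    have hinj : Function.Injective fun a : Fin (k + 1) =>
        (⟨(f (i, a) : Fin N) / d, hlt _⟩ : Fin (k + 1)) := by
      intro a b hab
      by_contra hne
      have hadj : (copiesK t (k + 1)).Adj (i, a) (i, b) := ⟨rfl, hne⟩
      exact blockColoring_blue (f.toHom.map_adj hadj) (Fin.mk.inj hab)
    obtain ⟨a, ha⟩ := (Finite.injective_iff_surjective.1 hinj) (Fin.last k)
    exact ⟨a, congrArg Fin.val ha⟩
  choose a ha using hlast
  have hcard := card_le_card_of_injOn (s := univ) (t := Ico (k * d) N)
    (fun i => ((f (i, a i) : Fin N) : ℕ)) (by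
      intro i _
      have := Nat.div_mul_le_self ((f (i, a i) : Fin N) : ℕ) d
      rw [ha i] at this
      rw [mem_coe, mem_Ico]
      exact ⟨this, (f (i, a i)).2⟩)
    fun i _ j _ h => congrArg Prod.fst (f.injective (Fin.ext h))
  simp only [card_univ, Fintype.card_fin, Nat.card_Ico] at hcard
  omega

/-- The lower bound `r(K_{1,d}, t K_{k+1}) ≥ k d + t`. The Ramsey number is assumed positive because
the infimum of an empty set of natural numbers is `0`. -/
theorem le_ramseyNumber {d k t : ℕ} (hd : 0 < d) (ht : 0 < t) (htd : t ≤ d)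
    (hr : 0 < ramseyNumber (starK d) (copiesK t (k + 1))) :
    k * d + t ≤ ramseyNumber (starK d) (copiesK t (k + 1)) := by
  by_contra! h
  have hmem := Nat.sInf_mem (Nat.nonempty_of_pos_sInf hr)
  rcases hmem (blockColoring _ d) with h' | h'
  · exact blockColoring_not_red hd h'
  · exact blockColoring_not_blue hd ht htd h h'

end StarCliques

theorem theorem2p3 (m t : ℕ) (hm : 0 < m) (ht : 0 < t) :
    ∃ n₀ : ℕ, ∀ n : ℕ, n₀ ≤ n →
      ∀ (V : Type*) [Fintype V] (C : TopEdgeLabeling V RBColor),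
        IsRamseyCritical C (starK (n - 1)) (copiesK t m) → MemFamilyG n m t C := by
  classical
  obtain ⟨k, rfl⟩ : ∃ k, m = k + 1 := ⟨m - 1, by omega⟩
  obtain ⟨c, hc⟩ : ∃ c, c = (k + 1) * t := ⟨_, rfl⟩
  obtain ⟨l, hl⟩ : ∃ l, l = c + k * c := ⟨_, rfl⟩
  refine ⟨3 * c + 3 * l + c * l + 2, fun n hn V _ C hC => ?_⟩
  obtain ⟨hcard, hred, hblue⟩ := hC
  have htc : t ≤ c := hc ▸ Nat.le_mul_of_pos_left t (Nat.succ_pos k)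
  have hN := StarCliques.le_ramseyNumber (d := n - 1) (k := k) (t := t) (by omega) ht (by omega)
    (by omega)
  obtain ⟨part, h1, h2, h3, h4⟩ := StarCliques.exists_partition
    (StarCliques.card_nonAdj_le hred) (hcard ▸ hN) hblue hc hl (by omega)
  refine ⟨part, fun i => ?_, fun u v h huv hi => ?_, fun u v h huv => ?_⟩
  · rw [Nat.card_eq_fintype_card, Fintype.card_subtype]
    rcases Fin.eq_castSucc_or_eq_last i with ⟨j, rfl⟩ | rfl
    · rw [if_pos (by simp), h1 j]
    · rw [if_neg (by simp)]
      omega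
  · rcases Fin.eq_castSucc_or_eq_last (part u) with ⟨j, hj⟩ | hu
    · exact StarCliques.get_eq_red_of_not_adj h (h3 u v j hj (huv ▸ hj))
    · simp [hu] at hi
  · exact StarCliques.get_eq_blue_of_adj h (h4 u v huv)
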